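/- **Robot.** Let $n\ge 1$ and consider the rigid robot $$D(q)\ddot q+C(q,\dot q)\dot q+g(q)=u,\qquad q\in\mathbb R^n,$$ where $D(q)\in\mathbb R^{n\times n}$ is symmetric positive definite for all $q$, $\dot D(q)-2C(q,\dot q)$ is skew-symmetric for all $(q,\dot q)$ (with $\dot D(q)$ the derivative of $D$ at $q$ in the direction $\dot q$), the functions $D$, $C$, $g$ are twice continuously differentiable, and there are positive constants $d_m,d_M,k_c,k_g$ such that for all $q,\dot q\in\mathbb R^n$ $$d_m\le\|D(q)\|\le d_M,\qquad \|C(q,\dot q)\|\le k_c\|\dot q\|,\qquad \Big\|\frac{\partial g}{\partial q}(q)\Big\|\le k_g$$ (Euclidean norm of vectors, induced norm of matrices). **Motors.** The torque is $u=k_t i$, where the current $i\in\mathbb R^n$ obeys $L\,\frac{di}{dt}+Ri+k_b\dot q=v$, with constants $L,R,k_t>0$ and $k_b\in\mathbb R$. **Controller.** Let $q^*\in\mathbb R^n$ be a constant set-point, $\tilde q=q-q^*$, and $$u^*=-k_p\tilde q-k_d\dot q+\nu,\qquad \dot\nu=-k_i\tilde q,\qquad i^*=\frac{u^*}{k_t},\qquad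 \tilde i=i-i^*,$$ $$v=-R'\tilde i+Ri^*+k_b\dot q+L\frac{di^*}{dt},$$ where $R'>-R$ is a fixed constant (in particular any $R'>0$), $di^*/dt$ is the derivative of $i^*$ along the closed loop, and $\theta=(k_p,k_d,k_i)$ are positive gains to be chosen. **Stability notions.** The origin of $\dot x=f(t,x)$ is *uniformly asymptotically stable (UAS) on* $\mathcal B_\Delta=\{x:\|x\|\le\Delta\}$ if solutions from every $t_0\ge0$ and $x_0\in\mathcal B_\Delta$ exist on $[t_0,\infty)$, and there are $\eta\in\mathcal K_\infty$ and $\sigma\in\mathcal L$ (i.e. $\sigma:[0,\infty)\to[0,\infty)$ continuous, non-increasing, tending to $0$) with $\|x(t)\|\le\eta(\|x_0\|)$ and $\|x(t)\|\le\sigma(t-t_0)$ for all such $t_0,x_0$ and all $t\ge t_0$. The system $\dot x=f(t,x,\theta)$ is *uniformly semiglobally asymptotically stable (USAS)* on a parameter set $\Theta$ if for every $\Delta>0$ there is $\theta\in\Theta$ such that the origin of $\dot x=f(t,x,\theta)$ is UAS on $\mathcal B_\Delta$. **Claim.** The closed loop, with the error state $x=\big(\tilde q,\ \dot q,\ \nu-g(q^*),\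 i-g(q^*)/k_t\big)\in\mathbb R^{4n}$, is USAS on the set of positive gains $(k_p,k_d,k_i)$. Moreover, there are positive constants $a_p,b_p,a_d,b_d,a_i,b_i,\varepsilon$ such that, for every $\Delta>0$, with the gains $$k_d=a_d+b_d\Delta,\qquad k_i=a_i+b_i\Delta,\qquad k_p-\frac{k_i}{\varepsilon}=a_p+b_p\Delta,$$ the origin of the closed loop is UAS on $\mathcal B_\Delta$, both in the error state $x$ and in the gain-dependent error state $$z=\big(\tilde q,\ \dot q,\ s,\ \tilde i\big),\qquad s=\frac{\tilde q}{\varepsilon}+\frac{g(q^*)-\nu}{k_i}.$$ -/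

import Mathlib

open scoped Matrix.Norms.L2Operator

noncomputable section

/-! ### Comparison functions and uniform semiglobal asymptotic stability -/

/-- Class `K∞` functions on `[0, ∞)` (the values on negative numbers are irrelevant). -/
def IsClassKInf (η : ℝ → ℝ) : Prop :=
  ContinuousOn η (Set.Ici 0) ∧ StrictMonoOn η (Set.Ici 0) ∧ η 0 = 0 ∧
    Filter.Tendsto η Filter.atTop Filter.atTop

/-- Class `L` functions on `[0, ∞)` (the values on negative numbers are irrelevant). -/
def IsClassL (σ : ℝ → ℝ) : Prop :=
  ContinuousOn σ (Set.Ici 0) ∧ AntitoneOn σ (Set.Ici 0) ∧ (∀ s, 0 ≤ s → 0 ≤ σ s) ∧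
    Filter.Tendsto σ Filter.atTop (nhds 0)

section Stability

variable {X : Type*} [NormedAddCommGroup X] [NormedSpace ℝ X] {P : Type*}

/-- `x` is a solution of `ẋ = f(t, x)` on the time interval `I`. -/
def IsSolutionOn (f : ℝ → X → X) (I : Set ℝ) (x : ℝ → X) : Prop :=
  ∀ t ∈ I, HasDerivWithinAt x (f t (x t)) I t

/-- From every initial time `t₀ ≥ 0` and every initial state in the closed ball of radius `Δ`,
there is a solution on the whole of `[t₀, ∞)`. -/
def IsForwardCompleteOn (f : ℝ → X → X) (Δ : ℝ) : Prop :=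
  ∀ t₀ : ℝ, 0 ≤ t₀ → ∀ x₀ : X, ‖x₀‖ ≤ Δ →
    ∃ x : ℝ → X, x t₀ = x₀ ∧ IsSolutionOn f (Set.Ici t₀) x

/-- Uniform stability of the origin on the closed ball of radius `Δ`.
The bound is imposed on every solution, on whatever interval it is defined. -/
def IsUniformlyStableOn (f : ℝ → X → X) (Δ : ℝ) : Prop :=
  ∃ η : ℝ → ℝ, IsClassKInf η ∧
    ∀ t₀ t : ℝ, 0 ≤ t₀ → t₀ ≤ t → ∀ x : ℝ → X, IsSolutionOn f (Set.Icc t₀ t) x →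
      ‖x t₀‖ ≤ Δ → ‖x t‖ ≤ η ‖x t₀‖

/-- Uniform attractivity of the origin on the closed ball of radius `Δ`. -/
def IsUniformlyAttractiveOn (f : ℝ → X → X) (Δ : ℝ) : Prop :=
  ∃ σ : ℝ → ℝ, IsClassL σ ∧
    ∀ t₀ t : ℝ, 0 ≤ t₀ → t₀ ≤ t → ∀ x : ℝ → X, IsSolutionOn f (Set.Icc t₀ t) x →
      ‖x t₀‖ ≤ Δ → ‖x t‖ ≤ σ (t - t₀)

/-- Uniform asymptotic stability (UAS) of the origin on the closed ball of radius `Δ`. -/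
def IsUASOn (f : ℝ → X → X) (Δ : ℝ) : Prop :=
  IsForwardCompleteOn f Δ ∧ IsUniformlyStableOn f Δ ∧ IsUniformlyAttractiveOn f Δ

/-- Uniform semiglobal asymptotic stability (USAS) of `ẋ = f(t, x, θ)` on the parameter
set `Θ`. -/
def IsUSAS (Θ : Set P) (f : ℝ → X → P → X) : Prop :=
  ∀ Δ : ℝ, 0 < Δ → ∃ θ ∈ Θ, IsUASOn (fun t x => f t x θ) Δ

end Stability

/-! ### The robot, the motors and the controller -/

/-- Joint space `ℝⁿ` with the Euclidean norm. -/
abbrev Joint (n : ℕ) := EuclideanSpace ℝ (Fin n)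

/-- The product `A v` of a matrix and a vector. -/
abbrev matVec {n : ℕ} (A : Matrix (Fin n) (Fin n) ℝ) (v : Joint n) : Joint n :=
  Matrix.toEuclideanCLM (n := Fin n) (𝕜 := ℝ) A v

/-- The data of the robot dynamics `D(q) q̈ + C(q, q̇) q̇ + g(q) = u`. -/
structure Robot (n : ℕ) where
  /-- inertia matrix -/
  D : Joint n → Matrix (Fin n) (Fin n) ℝ
  /-- Coriolis and centrifugal matrix -/
  C : Joint n → Joint n → Matrix (Fin n) (Fin n) ℝ
  /-- gravitational forces -/
  g : Joint n → Joint n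

/-- The standing assumptions on the robot; all matrix norms are the induced `L₂` norms, and
`fderiv ℝ M.D q w` is `Ḋ(q)` for `q̇ = w`. -/
structure Robot.StandingAssumption {n : ℕ} (M : Robot n) : Prop where
  posDef : ∀ q, (M.D q).PosDef
  skew : ∀ q w, (fderiv ℝ M.D q w - (2 : ℝ) • M.C q w).transpose =
    -(fderiv ℝ M.D q w - (2 : ℝ) • M.C q w)
  contDiff_D : ContDiff ℝ 2 M.D
  contDiff_C : ContDiff ℝ 2 (fun p : Joint n × Joint n => M.C p.1 p.2)
  contDiff_g : ContDiff ℝ 2 M.g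
  bound_D : ∃ d_m d_M : ℝ, 0 < d_m ∧ 0 < d_M ∧ ∀ q, d_m ≤ ‖M.D q‖ ∧ ‖M.D q‖ ≤ d_M
  bound_C : ∃ k_c : ℝ, 0 < k_c ∧ ∀ q w, ‖M.C q w‖ ≤ k_c * ‖w‖
  bound_g : ∃ k_g : ℝ, 0 < k_g ∧ ∀ q, ‖fderiv ℝ M.g q‖ ≤ k_g

/-- The acceleration `q̈` of the robot in configuration `q` with velocity `w` under the
torque `u`. -/
def Robot.accel {n : ℕ} (M : Robot n) (q w u : Joint n) : Joint n :=
  matVec (M.D q)⁻¹ (u - matVec (M.C q w) w - M.g q)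

/-- The constants of the `n` identical DC motors: `L i' + R i + k_b q̇ = v`, torque `u = k_t i`. -/
structure Motor where
  /-- inductance -/
  L : ℝ
  /-- resistance -/
  R : ℝ
  /-- back-emf constant -/
  k_b : ℝ
  /-- torque constant -/
  k_t : ℝ

/-- The gains of the PID controller. -/
structure PIDGains where
  /-- proportional gain -/
  k_p : ℝ
  /-- derivative gain -/
  k_d : ℝ
  /-- integral gain -/
  k_i : ℝ

/-- The set of admissible gains: all three are positive. -/
def positiveGains : Set PIDGains := {θ | 0 < θ.k_p ∧ 0 < θ.k_d ∧ 0 < θ.k_i}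

section ClosedLoop

variable {n : ℕ} (M : Robot n) (m : Motor) (R' : ℝ) (qs : Joint n) (θ : PIDGains)

/-- The PID law `u* = -k_p q̃ - k_d q̇ + ν`, as a function of `q`, `q̇ = w` and `ν`, with
`q̃ = q - q*`. -/
def torqueRef (q w ν : Joint n) : Joint n :=
  -(θ.k_p • (q - qs)) - θ.k_d • w + ν

/-- `i* = u* / k_t`. -/
def currentRef (q w ν : Joint n) : Joint n :=
  m.k_t⁻¹ • torqueRef qs θ q w ν

/-- The integral action `ν̇ = -k_i q̃`. -/
def integratorRate (q : Joint n) : Joint n := -(θ.k_i • (q - qs))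

/-- The derivative `di*/dt` along the closed loop: `i*` is differentiated in time, with `q̈`
given by the robot dynamics under the torque `u = k_t i` and `ν̇` by the integral action. -/
def currentRefRate (q w i : Joint n) : Joint n :=
  m.k_t⁻¹ • (-(θ.k_p • w) - θ.k_d • M.accel q w (m.k_t • i) + integratorRate qs θ q)

/-- The motor voltage `v = -R' ĩ + R i* + k_b q̇ + L di*/dt`, with `ĩ = i - i*`. -/
def voltage (q w ν i : Joint n) : Joint n :=
  -(R' • (i - currentRef m qs θ q w ν)) + m.R • currentRef m qs θ q w ν + m.k_b • w
    + m.L • currentRefRate M m qs θ q w i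

/-- The derivative of the current, from the motor equation `L i' + R i + k_b q̇ = v`. -/
def currentRate (q w ν i : Joint n) : Joint n :=
  m.L⁻¹ • (voltage M m R' qs θ q w ν i - m.R • i - m.k_b • w)

end ClosedLoop

/-- The state space `ℝⁿ × ℝⁿ × ℝⁿ × ℝⁿ` with the Euclidean norm. -/
abbrev LoopState (n : ℕ) := EuclideanSpace ℝ (Fin 4 × Fin n)

/-- The `k`-th of the four blocks of a state. -/
def LoopState.block {n : ℕ} (x : LoopState n) (k : Fin 4) : Joint n :=
  WithLp.toLp 2 fun j => x (k, j)

/-- The state with the blocks `a`, `b`, `c`, `d`. -/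
def LoopState.mk {n : ℕ} (a b c d : Joint n) : LoopState n :=
  WithLp.toLp 2 fun p => ![a, b, c, d] p.1 p.2

/-- The closed loop `ẋ = f(t, x, θ)` in the error state
`x = (q - q*, q̇, ν - g(q*), i - g(q*) / k_t)`, which vanishes exactly at the equilibrium. -/
def closedLoop {n : ℕ} (M : Robot n) (m : Motor) (R' : ℝ) (qs : Joint n)
    (_t : ℝ) (x : LoopState n) (θ : PIDGains) : LoopState n :=
  let q := qs + x.block 0
  let w := x.block 1
  let ν := M.g qs + x.block 2
  let i := m.k_t⁻¹ • M.g qs + x.block 3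
  LoopState.mk w (M.accel q w (m.k_t • i)) (integratorRate qs θ q)
    (currentRate M m R' qs θ q w ν i)

/-- The same closed loop in the gain-dependent error state `z = (q̃, q̇, s, ĩ)` with
`s = q̃ / ε + (g(q*) - ν) / k_i` and `ĩ = i - i*`. -/
def closedLoopTilde {n : ℕ} (M : Robot n) (m : Motor) (R' : ℝ) (qs : Joint n) (ε : ℝ)
    (_t : ℝ) (z : LoopState n) (θ : PIDGains) : LoopState n :=
  let q := qs + z.block 0
  let w := z.block 1
  let ν := M.g qs + θ.k_i • (ε⁻¹ • z.block 0 - z.block 2)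
  let i := currentRef m qs θ q w ν + z.block 3
  LoopState.mk w (M.accel q w (m.k_t • i)) (ε⁻¹ • w - θ.k_i⁻¹ • integratorRate qs θ q)
    (currentRate M m R' qs θ q w ν i - currentRefRate M m qs θ q w i)

end

/-!
The current error `j = i - i*` obeys the autonomous linear equation `L j' = -(R + R') j`, so the
closed loop is a PID-controlled rigid robot driven by an exponentially decaying torque `k_t j`.
In the error state `z`, with `ε = 1` and `k_d = k_i = k_p - k_i = κ`, it reads
`q' = w`, `s' = w + q`, `D w' = -C w - (g - g(q*)) - κ (q + w + s) + k_t j`, and the function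
`½ w·D w + q·D w + κ |q|² + ½ κ |s|² + (1/64) s·D w + γ |j|²` (`loopEnergy`) is a strict Lyapunov
function with exponential decay as long as `k_c |q|` and `k_c |s|` are at most `κ / 8`
(`fderiv_loopEnergy_le`). Here `Ḋ = C + Cᵀ` (`inner_fderiv_D`), obtained from the skew-symmetry of
`Ḋ - 2 C` and the symmetry of `D`, removes the Coriolis force from the kinetic energy balance.

The gains are linear in `Δ` because of a scaling count. On the ball of radius `Δ`, in either error
state, the energy is `O(κ Δ²)`: the initial current error may be `O(κ Δ)`, but its weight `γ`
is `O(1 / κ)`. As the energy dominates `κ |q|²` and `κ |s|²`, its sublevel set only reaches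
`|q|, |s| = O(Δ)`, where a gain `κ = A (1 + Δ)` with `A` large makes the decay estimate valid
(`isUASOn_balancedGains`).

The hypotheses bound the norm of `D` from below but not its least eigenvalue. This is harmless: on
the sublevel set `q` stays in a compact set, where `D` is uniformly positive definite
(`exists_inner_D_ge`); the resulting constant enters the comparison functions, not the gains.
Uniform asymptotic stability then follows from Lyapunov's criterion on a bounded sublevel set
(`isUASOn_of_lyapunov`), including the existence of solutions for all times.
-/

/-! ### Global solutions of bounded Lipschitz vector fields -/

section ODE

open Set

variable {E : Type*} [NormedAddCommGroup E] [NormedSpace ℝ E]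

/-- Solutions of an autonomous Lipschitz equation on a common compact interval agree if they
start at the same point. -/
lemma IsSolutionOn.eqOn_of_lipschitz {F : E → E} {K : NNReal} (hF : LipschitzWith K F)
    {a b : ℝ} {x y : ℝ → E} (hx : IsSolutionOn (fun _ => F) (Icc a b) x)
    (hy : IsSolutionOn (fun _ => F) (Icc a b) y) (h : x a = y a) : EqOn x y (Icc a b) := by
  have right : ∀ {z : ℝ → E}, IsSolutionOn (fun _ => F) (Icc a b) z →
      ∀ t ∈ Ico a b, HasDerivWithinAt z (F (z t)) (Ici t) t := fun hz t ht =>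
    (hz t (Ico_subset_Icc_self ht)).mono_of_mem_nhdsWithin (Icc_mem_nhdsGE_of_mem ht)
  exact ODE_solution_unique_of_mem_Icc_right (v := fun _ => F) (s := fun _ => univ)
    (fun t _ => hF.lipschitzOnWith) (fun t ht => (hx t ht).continuousWithinAt) (right hx)
    (fun _ _ => mem_univ _) (fun t ht => (hy t ht).continuousWithinAt) (right hy)
    (fun _ _ => mem_univ _) h

/-- For a bounded vector field the radius in the Picard–Lindelöf theorem may grow with the length
of the time interval, so solutions exist on every compact interval. -/
lemma exists_isSolutionOn_Icc [CompleteSpace E] {F : E → E} {K L : NNReal}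
    (hF : LipschitzWith K F) (hb : ∀ x, ‖F x‖ ≤ L) (t₀ : ℝ) (x₀ : E) (T : NNReal) :
    ∃ x : ℝ → E, x t₀ = x₀ ∧ IsSolutionOn (fun _ => F) (Icc t₀ (t₀ + T)) x := by
  have hT : t₀ ≤ t₀ + T := le_add_of_nonneg_right T.2
  have hPL : IsPicardLindelof (fun _ => F) (tmin := t₀) (tmax := t₀ + T)
      ⟨t₀, left_mem_Icc.2 hT⟩ x₀ (L * T) 0 L K := by
    refine IsPicardLindelof.of_time_independent (fun x _ => hb x) hF.lipschitzOnWith ?_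
    simp
  exact hPL.exists_eq_forall_mem_Icc_hasDerivWithinAt₀

lemma exists_isSolutionOn_Ici [CompleteSpace E] {F : E → E} {K L : NNReal}
    (hF : LipschitzWith K F) (hb : ∀ x, ‖F x‖ ≤ L) (t₀ : ℝ) (x₀ : E) :
    ∃ x : ℝ → E, x t₀ = x₀ ∧ IsSolutionOn (fun _ => F) (Ici t₀) x := by
  choose y hy0 hy using fun N : ℕ => exists_isSolutionOn_Icc hF hb t₀ x₀ (N : NNReal)
  simp only [NNReal.coe_natCast] at hy
  have agree : ∀ M N : ℕ, M ≤ N → EqOn (y M) (y N) (Icc t₀ (t₀ + M)) := by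
    intro M N hMN
    have hsub : Icc t₀ (t₀ + M) ⊆ Icc t₀ (t₀ + N) :=
      Icc_subset_Icc_right (by have : (M : ℝ) ≤ N := by exact_mod_cast hMN
                               linarith)
    exact (hy M).eqOn_of_lipschitz hF (fun t ht => (hy N t (hsub ht)).mono hsub)
      ((hy0 M).trans (hy0 N).symm)
  -- at time `t` the solution is read off from the one living on an interval reaching past `t`
  let x : ℝ → E := fun t => y (⌈t - t₀⌉₊) t
  have hx : ∀ N : ℕ, EqOn x (y N) (Icc t₀ (t₀ + N)) := by
    intro N t ht
    refine agree _ _ (Nat.ceil_le.2 (by linarith [ht.2])) ⟨ht.1, ?_⟩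
    linarith [Nat.le_ceil (t - t₀)]
  refine ⟨x, (hx 0 ⟨le_rfl, by simp⟩).trans (hy0 0), fun t ht => ?_⟩
  obtain ⟨N, hN⟩ := exists_nat_gt (t - t₀)
  have hmem : t ∈ Icc t₀ (t₀ + N) := ⟨ht, by linarith⟩
  have hd := (hy N t hmem).congr (fun s hs => hx N hs) (hx N hmem)
  rw [← hx N hmem] at hd
  refine hd.mono_of_mem_nhdsWithin ?_
  rw [← Ici_inter_Iic]
  exact inter_mem_nhdsWithin _ (Iic_mem_nhds (by linarith))

end ODE

/-! ### Exponential Lyapunov functions on a sublevel set -/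

section Lyapunov

open Set

variable {E : Type*} [NormedAddCommGroup E] [NormedSpace ℝ E]

/-- A Lyapunov function that decays at rate `c` on its sublevel set `{W ≤ r}` makes this set
invariant and decays exponentially along every solution starting in it. -/
lemma IsSolutionOn.lyapunov_decay {F : E → E} {W : E → ℝ} (hW : Differentiable ℝ W) {r c : ℝ}
    (hr : 0 < r) (hc : 0 < c)
    (hdec : ∀ x, W x ≤ r → fderiv ℝ W x (F x) ≤ -c * W x)
    {a b : ℝ} {x : ℝ → E} (hx : IsSolutionOn (fun _ => F) (Icc a b) x) (ha : W (x a) ≤ r) :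
    ∀ t ∈ Icc a b, W (x t) ≤ r ∧ W (x t) ≤ W (x a) * Real.exp (-c * (t - a)) := by
  have hcont : ContinuousOn (fun t => W (x t)) (Icc a b) := fun t ht =>
    (hW (x t)).continuousAt.comp_continuousWithinAt (hx t ht).continuousWithinAt
  have hder : ∀ t ∈ Ico a b,
      HasDerivWithinAt (fun t => W (x t)) (fderiv ℝ W (x t) (F (x t))) (Ici t) t := fun t ht =>
    (hW (x t)).hasFDerivAt.comp_hasDerivWithinAt t
      ((hx t (Ico_subset_Icc_self ht)).mono_of_mem_nhdsWithin (Icc_mem_nhdsGE_of_mem ht))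
  have inv : ∀ t ∈ Icc a b, W (x t) ≤ r := by
    refine image_le_of_deriv_right_lt_deriv_boundary (B := fun _ => r) (B' := fun _ => 0)
      hcont hder ha (fun t => hasDerivAt_const t r) fun t ht h => ?_
    refine (hdec (x t) h.le).trans_lt ?_
    change W (x t) = r at h
    rw [h]
    nlinarith
  refine fun t ht => ⟨inv t ht, ?_⟩
  have hexp : ∀ t, HasDerivAt (fun t => Real.exp (c * (t - a))) (Real.exp (c * (t - a)) * c) t := by
    intro t
    simpa using (((hasDerivAt_id t).sub_const a).const_mul c).exp
  have key : W (x t) * Real.exp (c * (t - a)) ≤ W (x a) := by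
    refine image_le_of_deriv_right_le_deriv_boundary (f := fun t => W (x t) * Real.exp (c * (t - a)))
      (B := fun _ => W (x a)) (B' := fun _ => 0) (hcont.mul (by fun_prop))
      (fun t ht => (hder t ht).mul (hexp t).hasDerivWithinAt) (by simp) continuousOn_const
      (fun t _ => hasDerivWithinAt_const _ _ _) (fun t ht => ?_) ht
    have := hdec (x t) (inv t (Ico_subset_Icc_self ht))
    have h2 := Real.exp_pos (c * (t - a))
    nlinarith
  have h3 : Real.exp (c * (t - a)) * Real.exp (-c * (t - a)) = 1 := by
    rw [← Real.exp_add]; simp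
  calc W (x t) = W (x t) * Real.exp (c * (t - a)) * Real.exp (-c * (t - a)) := by
        rw [mul_assoc, h3, mul_one]
    _ ≤ _ := mul_le_mul_of_nonneg_right key (Real.exp_pos _).le

/-- A `C¹` vector field is forward complete on a ball contained in a bounded sublevel set of a
Lyapunov function: a compactly supported modification away from the sublevel set has global
solutions, and these never leave the sublevel set. -/
lemma isForwardCompleteOn_of_lyapunov [FiniteDimensional ℝ E] {F : E → E} (hF : ContDiff ℝ 1 F)
    {W : E → ℝ} (hW : Differentiable ℝ W) {Δ r c ρ : ℝ} (hr : 0 < r) (hc : 0 < c)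
    (hball : ∀ x, ‖x‖ ≤ Δ → W x ≤ r) (hbdd : ∀ x, W x ≤ r → ‖x‖ ≤ ρ)
    (hdec : ∀ x, W x ≤ r → fderiv ℝ W x (F x) ≤ -c * W x) :
    IsForwardCompleteOn (fun _ => F) Δ := by
  intro t₀ _ x₀ hx₀
  have hρ : 0 ≤ ρ := (norm_nonneg x₀).trans (hbdd x₀ (hball x₀ hx₀))
  let χ : ContDiffBump (0 : E) := ⟨ρ + 1, ρ + 2, by linarith, by linarith⟩
  let G : E → E := fun x => χ x • F x
  have hGF : ∀ x, W x ≤ r → G x = F x := by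
    intro x hx
    have : χ x = 1 := χ.one_of_mem_closedBall (by simpa using (hbdd x hx).trans (by simp [χ]))
    simp [G, this]
  have hGsmooth : ContDiff ℝ 1 G := χ.contDiff.smul hF
  have hGsupp : HasCompactSupport G := χ.hasCompactSupport.smul_right
  obtain ⟨K, hK⟩ := ContDiff.lipschitzWith_of_hasCompactSupport hGsupp hGsmooth one_ne_zero
  obtain ⟨L, hL⟩ := hGsupp.exists_bound_of_continuous hGsmooth.continuous
  obtain ⟨x, hx0, hx⟩ := exists_isSolutionOn_Ici (L := L.toNNReal) hK
    (fun x => (hL x).trans (Real.le_coe_toNNReal L)) t₀ x₀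
  refine ⟨x, hx0, fun t ht => ?_⟩
  have hx' : IsSolutionOn (fun _ => G) (Icc t₀ t) x := fun s hs =>
    (hx s hs.1).mono Icc_subset_Ici_self
  have := (hx'.lyapunov_decay hW hr hc (fun y hy => by rw [hGF y hy]; exact hdec y hy)
    (by rw [hx0]; exact hball x₀ hx₀) t ⟨ht, le_rfl⟩).1
  simpa only [hGF _ this] using hx t ht

/-- Lyapunov's criterion on a ball: if a sublevel set of `W` contains the ball, and on the
sublevel set `W` is comparable to the squared norm and decays exponentially, then the origin is
uniformly asymptotically stable on the ball. -/
theorem isUASOn_of_lyapunov [FiniteDimensional ℝ E] {F : E → E} (hF : ContDiff ℝ 1 F)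
    {W : E → ℝ} (hW : Differentiable ℝ W) {Δ r a b c : ℝ} (hΔ : 0 ≤ Δ) (hr : 0 < r) (ha : 0 < a)
    (hb : 0 < b) (hc : 0 < c) (hball : ∀ x, ‖x‖ ≤ Δ → W x ≤ r)
    (hlow : ∀ x, W x ≤ r → a * ‖x‖ ^ 2 ≤ W x) (hup : ∀ x, W x ≤ r → W x ≤ b * ‖x‖ ^ 2)
    (hdec : ∀ x, W x ≤ r → fderiv ℝ W x (F x) ≤ -c * W x) :
    IsUASOn (fun _ => F) Δ := by
  have hba : 0 < b / a := div_pos hb ha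
  have main : ∀ t₀ t : ℝ, t₀ ≤ t → ∀ x : ℝ → E, IsSolutionOn (fun _ => F) (Icc t₀ t) x →
      ‖x t₀‖ ≤ Δ → ‖x t‖ ≤ √(b / a) * ‖x t₀‖ * Real.exp (-(c / 2) * (t - t₀)) := by
    intro t₀ t ht x hx hx0
    have h0 := hball _ hx0
    obtain ⟨h1, h2⟩ := hx.lyapunov_decay hW hr hc hdec h0 t ⟨ht, le_rfl⟩
    have h3 := hlow _ h1
    have h4 := mul_le_mul_of_nonneg_right (hup _ h0) (Real.exp_pos (-c * (t - t₀))).le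
    have h5 : Real.exp (-c * (t - t₀)) = Real.exp (-(c / 2) * (t - t₀)) ^ 2 := by
      rw [← Real.exp_nat_mul]; congr 1; push_cast; ring
    refine (sq_le_sq₀ (norm_nonneg _) (by positivity)).1 ?_
    rw [mul_pow, mul_pow, Real.sq_sqrt hba.le, ← h5, div_mul_eq_mul_div, div_mul_eq_mul_div,
      le_div_iff₀ ha]
    linarith
  refine ⟨isForwardCompleteOn_of_lyapunov hF hW hr hc hball (ρ := √(r / a)) (fun x hx => ?_) hdec,
    ⟨fun s => √(b / a) * s, ⟨by fun_prop, fun s _ t _ hst => ?_, by simp, ?_⟩, ?_⟩,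
    ⟨fun s => √(b / a) * Δ * Real.exp (-(c / 2) * s), ⟨by fun_prop, fun s _ t _ hst => ?_,
      fun s _ => by positivity, ?_⟩, ?_⟩⟩
  · exact Real.le_sqrt_of_sq_le ((le_div_iff₀ ha).2 (by linarith [hlow x hx]))
  · exact mul_lt_mul_of_pos_left hst (Real.sqrt_pos.2 hba)
  · exact Filter.tendsto_id.const_mul_atTop (Real.sqrt_pos.2 hba)
  · intro t₀ t _ ht x hx hx0
    refine (main t₀ t ht x hx hx0).trans (mul_le_of_le_one_right (by positivity) ?_)
    exact Real.exp_le_one_iff.2 (by nlinarith)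
  · have : Real.exp (-(c / 2) * t) ≤ Real.exp (-(c / 2) * s) := Real.exp_le_exp.2 (by nlinarith)
    exact mul_le_mul_of_nonneg_left this (by positivity)
  · have h : Filter.Tendsto (fun s : ℝ => -(c / 2) * s) Filter.atTop Filter.atBot :=
      Filter.tendsto_id.const_mul_atTop_of_neg (by linarith)
    simpa using (Real.tendsto_exp_atBot.comp h).const_mul (√(b / a) * Δ)
  · intro t₀ t _ ht x hx hx0
    refine (main t₀ t ht x hx hx0).trans ?_
    exact mul_le_mul_of_nonneg_right (mul_le_mul_of_nonneg_left hx0 (Real.sqrt_nonneg _))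
      (Real.exp_pos _).le

end Lyapunov

/-! ### The inertia and Coriolis operators -/

section Operators

open scoped RealInnerProductSpace

variable {n : ℕ}

/-- The identification of matrices with operators on joint space, as a continuous linear map. -/
noncomputable def matOp (n : ℕ) : Matrix (Fin n) (Fin n) ℝ →L[ℝ] (Joint n →L[ℝ] Joint n) :=
  LinearMap.toContinuousLinearMap
    (Matrix.toEuclideanCLM (n := Fin n) (𝕜 := ℝ)).toAlgEquiv.toLinearMap

lemma matVec_eq (A : Matrix (Fin n) (Fin n) ℝ) (x : Joint n) : matVec A x = matOp n A x := rfl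

lemma inner_matOp_transpose (A : Matrix (Fin n) (Fin n) ℝ) (x y : Joint n) :
    ⟪x, matOp n A.transpose y⟫ = ⟪matOp n A x, y⟫ := by
  have h : matOp n A.transpose = ContinuousLinearMap.adjoint (matOp n A) := by
    rw [← Matrix.conjTranspose_eq_transpose_of_trivial]
    exact map_star (Matrix.toEuclideanCLM (n := Fin n) (𝕜 := ℝ)) A
  rw [h]
  exact ContinuousLinearMap.adjoint_inner_right _ _ _

lemma norm_matOp_le (A : Matrix (Fin n) (Fin n) ℝ) (x : Joint n) :
    ‖matOp n A x‖ ≤ ‖A‖ * ‖x‖ :=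
  ContinuousLinearMap.le_opNorm (matOp n A) x

lemma matOp_mul (A B : Matrix (Fin n) (Fin n) ℝ) (x : Joint n) :
    matOp n (A * B) x = matOp n A (matOp n B x) :=
  congrArg (fun T : Joint n →L[ℝ] Joint n => T x)
    (map_mul (Matrix.toEuclideanCLM (n := Fin n) (𝕜 := ℝ)) A B)

lemma matOp_one (x : Joint n) : matOp n 1 x = x :=
  congrArg (fun T : Joint n →L[ℝ] Joint n => T x)
    (map_one (Matrix.toEuclideanCLM (n := Fin n) (𝕜 := ℝ)))

namespace Robot.StandingAssumption

variable {M : Robot n}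

lemma inner_D_pos (hM : M.StandingAssumption) (q : Joint n) {x : Joint n} (hx : x ≠ 0) :
    0 < ⟪x, matOp n (M.D q) x⟫ := by
  change 0 < ⟪x, Matrix.toEuclideanCLM (n := Fin n) (𝕜 := ℝ) (M.D q) x⟫
  rw [Matrix.inner_toEuclideanCLM]
  simpa using (hM.posDef q).dotProduct_mulVec_pos (x := x.ofLp) (by simpa using hx)

lemma inner_D_nonneg (hM : M.StandingAssumption) (q x : Joint n) :
    0 ≤ ⟪x, matOp n (M.D q) x⟫ := by
  rcases eq_or_ne x 0 with rfl | hx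
  · simp
  · exact (hM.inner_D_pos q hx).le

lemma transpose_D (hM : M.StandingAssumption) (q : Joint n) : (M.D q).transpose = M.D q := by
  rw [← Matrix.conjTranspose_eq_transpose_of_trivial]
  exact (hM.posDef q).isHermitian

lemma inner_D_comm (hM : M.StandingAssumption) (q x y : Joint n) :
    ⟪x, matOp n (M.D q) y⟫ = ⟪matOp n (M.D q) x, y⟫ := by
  rw [← inner_matOp_transpose, hM.transpose_D]

lemma differentiable_D (hM : M.StandingAssumption) : Differentiable ℝ M.D :=
  hM.contDiff_D.differentiable (by norm_num)

lemma hasDerivAt_D (hM : M.StandingAssumption) {q : ℝ → Joint n} {q₀ q' : Joint n} {t : ℝ}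
    (hq : HasDerivAt q q' t) (h : q t = q₀) :
    HasDerivAt (fun t => matOp n (M.D (q t))) (matOp n (fderiv ℝ M.D q₀ q')) t := by
  subst h
  exact ((matOp n).hasFDerivAt.comp (q t) (hM.differentiable_D (q t)).hasFDerivAt).comp_hasDerivAt
    t hq

/-- Differentiating the symmetry of `D`, the skew-symmetry of `Ḋ - 2 C` becomes `Ḋ = C + Cᵀ`. -/
lemma inner_fderiv_D (hM : M.StandingAssumption) (q w x y : Joint n) :
    ⟪x, matOp n (fderiv ℝ M.D q w) y⟫
      = ⟪x, matOp n (M.C q w) y⟫ + ⟪matOp n (M.C q w) x, y⟫ := by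
  have hline : HasDerivAt (fun t : ℝ => q + t • w) w 0 := by
    simpa using ((hasDerivAt_id (0 : ℝ)).smul_const w).const_add q
  have hop : HasDerivAt (fun t : ℝ => matOp n (M.D (q + t • w))) (matOp n (fderiv ℝ M.D q w)) 0 :=
    hM.hasDerivAt_D (q := fun t : ℝ => q + t • w) (by simpa using hline) (by simp)
  have h1 := (hasDerivAt_const (0 : ℝ) x).inner ℝ (hop.clm_apply (hasDerivAt_const (0 : ℝ) y))
  have h2 := (hop.clm_apply (hasDerivAt_const (0 : ℝ) x)).inner ℝ (hasDerivAt_const (0 : ℝ) y)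
  have hsymm : ⟪x, matOp n (fderiv ℝ M.D q w) y⟫ = ⟪matOp n (fderiv ℝ M.D q w) x, y⟫ := by
    have := h1.unique (h2.congr_of_eventuallyEq
      (Filter.Eventually.of_forall fun t => hM.inner_D_comm (q + t • w) x y))
    simpa using this
  have hskew := inner_matOp_transpose (fderiv ℝ M.D q w - (2 : ℝ) • M.C q w) x y
  rw [hM.skew] at hskew
  simp only [map_neg, map_sub, map_smul, neg_apply,
    sub_apply, smul_apply, inner_neg_right,
    inner_sub_right, inner_sub_left, inner_smul_left, inner_smul_right, RCLike.conj_to_real]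
    at hskew
  linarith

/-- The equations of motion, solved for the inertial force. -/
lemma D_accel (hM : M.StandingAssumption) (q w u : Joint n) :
    matOp n (M.D q) (M.accel q w u) = u - matOp n (M.C q w) w - M.g q := by
  have hdet : IsUnit (M.D q).det := (Matrix.isUnit_iff_isUnit_det _).1 (hM.posDef q).isUnit
  rw [Robot.accel, matVec_eq, matVec_eq, ← matOp_mul, Matrix.mul_nonsing_inv _ hdet, matOp_one]

/-- On bounded sets of configurations the inertia matrix is bounded below. -/
lemma exists_inner_D_ge (hM : M.StandingAssumption) (qs : Joint n) (ρ : ℝ) :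
    ∃ d : ℝ, 0 < d ∧ ∀ a w : Joint n, ‖a‖ ≤ ρ →
      d * ‖w‖ ^ 2 ≤ ⟪w, matOp n (M.D (qs + a)) w⟫ := by
  have hcont : Continuous fun p : Joint n × Joint n =>
      ⟪p.2, matOp n (M.D (qs + p.1)) p.2⟫ := by
    have := hM.contDiff_D.continuous
    fun_prop
  obtain ⟨d, hd, h⟩ := ((isCompact_closedBall (0 : Joint n) ρ).prod
    (isCompact_sphere (0 : Joint n) 1)).exists_forall_le' hcont.continuousOn (a := 0)
    fun p hp => hM.inner_D_pos _ fun h0 => by simpa [h0] using hp.2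
  refine ⟨d, hd, fun a w ha => ?_⟩
  rcases eq_or_ne w 0 with rfl | hw
  · simp
  have hw' : 0 < ‖w‖ := norm_pos_iff.2 hw
  have := h (a, ‖w‖⁻¹ • w) ⟨by simpa using ha, by simp [norm_smul, hw'.ne']⟩
  simp only [map_smul, inner_smul_left, inner_smul_right, RCLike.conj_to_real] at this
  calc d * ‖w‖ ^ 2 ≤ ‖w‖⁻¹ * (‖w‖⁻¹ * ⟪w, matOp n (M.D (qs + a)) w⟫) * ‖w‖ ^ 2 := by gcongr
    _ = _ := by field_simp

lemma contDiff_accel (hM : M.StandingAssumption) :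
    ContDiff ℝ 1 fun p : Joint n × Joint n × Joint n => M.accel p.1 p.2.1 p.2.2 := by
  have hinv : ContDiff ℝ 1 fun q => (M.D q)⁻¹ := by
    rw [contDiff_iff_contDiffAt]
    intro q
    obtain ⟨u, hu⟩ := (hM.posDef q).isUnit
    have h1 : ContDiffAt ℝ 1 Ring.inverse (M.D q) := hu ▸ contDiffAt_ringInverse ℝ u
    simpa only [Function.comp_def, ← Matrix.nonsing_inv_eq_ringInverse] using
      h1.comp q (hM.contDiff_D.of_le (by norm_num)).contDiffAt
  have hC : ContDiff ℝ 1 fun p : Joint n × Joint n × Joint n => M.C p.1 p.2.1 :=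
    (hM.contDiff_C.of_le (by norm_num)).comp (contDiff_fst.prodMk contDiff_snd.fst)
  have hg : ContDiff ℝ 1 fun p : Joint n × Joint n × Joint n => M.g p.1 :=
    (hM.contDiff_g.of_le (by norm_num)).comp contDiff_fst
  have hinv' : ContDiff ℝ 1 fun p : Joint n × Joint n × Joint n => (M.D p.1)⁻¹ :=
    hinv.comp contDiff_fst
  exact ((matOp n).contDiff.comp hinv').clm_apply ((contDiff_snd.snd.sub
    (((matOp n).contDiff.comp hC).clm_apply contDiff_snd.fst)).sub hg)

end Robot.StandingAssumption
end Operators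

/-! ### The energy function of the error system -/

section Energy

open scoped RealInnerProductSpace

variable {H : Type*} [NormedAddCommGroup H] [InnerProductSpace ℝ H]

/-- The Lyapunov function, for a frozen inertia operator `P`: `q` is the position error, `w` the
velocity, `s` the shifted integrator state and `j` the current error. The cross term in `q` and `w`
produces decay in `q`, the small one in `s` and `w` produces decay in `s`, and `γ ‖j‖²` dominates
the torque caused by the current error. -/
noncomputable def energy (P : H →L[ℝ] H) (κ γ : ℝ) (q w s j : H) : ℝ :=
  1 / 2 * ⟪w, P w⟫ + ⟪q, P w⟫ + κ * ‖q‖ ^ 2 + κ / 2 * ‖s‖ ^ 2 + 1 / 64 * ⟪s, P w⟫ + γ * ‖j‖ ^ 2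

lemma inner_le_of_norm_le {x y : H} {c r : ℝ} (h : ‖y‖ ≤ c * r) : ⟪x, y⟫ ≤ c * (‖x‖ * r) := by
  calc ⟪x, y⟫ ≤ ‖x‖ * ‖y‖ := real_inner_le_norm x y
    _ ≤ ‖x‖ * (c * r) := by gcongr
    _ = _ := by ring

lemma le_energy {P : H →L[ℝ] H} (hsymm : ∀ x y, ⟪x, P y⟫ = ⟪P x, y⟫) (hpos : ∀ x, 0 ≤ ⟪x, P x⟫)
    {κ : ℝ} (hκ : 0 ≤ κ) (hP : ∀ x, ‖P x‖ ≤ κ / 8 * ‖x‖) (γ : ℝ) (q w s j : H) :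
    1 / 8 * ⟪w, P w⟫ + κ / 2 * ‖q‖ ^ 2 + κ / 4 * ‖s‖ ^ 2 + γ * ‖j‖ ^ 2
      ≤ energy P κ γ q w s j := by
  have hcomm : ∀ x y, ⟪x, P y⟫ = ⟪y, P x⟫ := fun x y => by rw [hsymm, real_inner_comm]
  have h1 := hpos ((1 / 2 : ℝ) • w + q)
  have h2 := hpos (w + s)
  have h3 : ⟪q, P q⟫ ≤ _ := inner_le_of_norm_le (hP q)
  have h4 : ⟪s, P s⟫ ≤ _ := inner_le_of_norm_le (hP s)
  simp only [map_add, map_smul, inner_add_left, inner_add_right, inner_smul_left,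
    inner_smul_right, RCLike.conj_to_real, hcomm w q, hcomm w s] at h1 h2
  have h5 : 0 ≤ κ * ‖q‖ ^ 2 := by positivity
  have h6 : 0 ≤ κ * ‖s‖ ^ 2 := by positivity
  have h7 := hpos w
  unfold energy
  nlinarith

lemma energy_le {P : H →L[ℝ] H} {κ : ℝ} (hκ : 0 ≤ κ) (hP : ∀ x, ‖P x‖ ≤ κ / 8 * ‖x‖) (γ : ℝ)
    (q w s j : H) :
    energy P κ γ q w s j ≤ κ * (‖w‖ ^ 2 + 2 * ‖q‖ ^ 2 + ‖s‖ ^ 2) + γ * ‖j‖ ^ 2 := by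
  have h1 : ⟪w, P w⟫ ≤ _ := inner_le_of_norm_le (hP w)
  have h2 : ⟪q, P w⟫ ≤ _ := inner_le_of_norm_le (hP w)
  have h3 : ⟪s, P w⟫ ≤ _ := inner_le_of_norm_le (hP w)
  have h4 := mul_nonneg hκ (sq_nonneg (‖q‖ - ‖w‖))
  have h5 := mul_nonneg hκ (sq_nonneg (‖s‖ - ‖w‖))
  have h6 : 0 ≤ κ * ‖q‖ ^ 2 := by positivity
  have h7 : 0 ≤ κ * ‖s‖ ^ 2 := by positivity
  have h8 : 0 ≤ κ * ‖w‖ ^ 2 := by positivity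
  unfold energy
  nlinarith

lemma HasDerivAt.energy {P : ℝ → H →L[ℝ] H} {P' : H →L[ℝ] H} {q w s j : ℝ → H}
    {q' w' s' j' : H} {t : ℝ} (hP : HasDerivAt P P' t) (hq : HasDerivAt q q' t)
    (hw : HasDerivAt w w' t) (hs : HasDerivAt s s' t) (hj : HasDerivAt j j' t) (κ γ : ℝ) :
    HasDerivAt (fun t => _root_.energy (P t) κ γ (q t) (w t) (s t) (j t))
      (1 / 2 * (⟪w t, P' (w t) + P t w'⟫ + ⟪w', P t (w t)⟫)
        + (⟪q t, P' (w t) + P t w'⟫ + ⟪q', P t (w t)⟫)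
        + κ * (2 * ⟪q t, q'⟫) + κ / 2 * (2 * ⟪s t, s'⟫)
        + 1 / 64 * (⟪s t, P' (w t) + P t w'⟫ + ⟪s', P t (w t)⟫) + γ * (2 * ⟪j t, j'⟫)) t := by
  have hPw := hP.clm_apply hw
  exact ((((((hw.inner ℝ hPw).const_mul _).add (hq.inner ℝ hPw)).add (hq.norm_sq.const_mul κ)).add
    (hs.norm_sq.const_mul _)).add ((hs.inner ℝ hPw).const_mul _)).add (hj.norm_sq.const_mul γ)

/-- The energy rate along the error system `q' = w`, `s' = w + q`, `j' = -a j`,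
`P w' = -C w - G - κ (q + w + s) + k j`, where `P' = C + Cᵀ`: the skew-symmetry removes the
Coriolis force from the kinetic energy balance, and the integrator exchanges energy losslessly. -/
lemma energy_rate_eq {P P' C : H →L[ℝ] H} (hsymm : ∀ x y, ⟪x, P y⟫ = ⟪P x, y⟫)
    (hP' : ∀ x y, ⟪x, P' y⟫ = ⟪x, C y⟫ + ⟪C x, y⟫) (κ γ a k : ℝ) (q w s j G w' : H)
    (hw' : P w' = -C w - G - κ • q - κ • w - κ • s + k • j) :
    1 / 2 * (⟪w, P' w + P w'⟫ + ⟪w', P w⟫) + (⟪q, P' w + P w'⟫ + ⟪w, P w⟫)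
        + κ * (2 * ⟪q, w⟫) + κ / 2 * (2 * ⟪s, w + q⟫)
        + 1 / 64 * (⟪s, P' w + P w'⟫ + ⟪w + q, P w⟫) + γ * (2 * ⟪j, -(a • j)⟫)
      = -κ * ‖w‖ ^ 2 + ⟪w, P w⟫ + ⟪w, C q⟫ - ⟪w, G⟫ - ⟪q, G⟫ - κ * ‖q‖ ^ 2
        + ⟪w, k • j⟫ + ⟪q, k • j⟫
        + 1 / 64 * (⟪w, P w⟫ + ⟪q, P w⟫ + ⟪w, C s⟫ - ⟪s, G⟫ - κ * ⟪s, q⟫ - κ * ⟪s, w⟫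
          - κ * ‖s‖ ^ 2 + ⟪s, k • j⟫) - 2 * a * γ * ‖j‖ ^ 2 := by
  rw [hsymm w' w, hw']
  simp only [inner_add_right, inner_add_left, inner_sub_right, inner_sub_left, inner_neg_right,
    inner_neg_left, hP', inner_smul_left, inner_smul_right, RCLike.conj_to_real,
    ← real_inner_self_eq_norm_sq, real_inner_comm q w, real_inner_comm s w, real_inner_comm s q,
    real_inner_comm (C _) w, real_inner_comm G w, real_inner_comm j w]
  ring

/-- Dissipation: if inertia, Coriolis and gravity terms are small compared with the gain `κ`, the
energy rate is negative definite. The weight `γ` is such that `2 a γ ‖j‖² = 8 ‖k j‖² / κ`. -/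
lemma energy_rate_le {P C : H →L[ℝ] H} {κ γ a k : ℝ} {q w s j G : H} (hκ : 0 < κ)
    (hP : ∀ x, ‖P x‖ ≤ κ / 8 * ‖x‖)
    (hCq : ‖C q‖ ≤ κ / 8 * ‖w‖) (hCs : ‖C s‖ ≤ κ / 8 * ‖w‖) (hG : ‖G‖ ≤ κ / 8 * ‖q‖)
    (hγ : a * κ * γ = 4 * k ^ 2) :
    -κ * ‖w‖ ^ 2 + ⟪w, P w⟫ + ⟪w, C q⟫ - ⟪w, G⟫ - ⟪q, G⟫ - κ * ‖q‖ ^ 2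
        + ⟪w, k • j⟫ + ⟪q, k • j⟫
        + 1 / 64 * (⟪w, P w⟫ + ⟪q, P w⟫ + ⟪w, C s⟫ - ⟪s, G⟫ - κ * ⟪s, q⟫ - κ * ⟪s, w⟫
          - κ * ‖s‖ ^ 2 + ⟪s, k • j⟫) - 2 * a * γ * ‖j‖ ^ 2
      ≤ -(1 / 128) * (κ * (‖w‖ ^ 2 + 2 * ‖q‖ ^ 2 + ‖s‖ ^ 2)) - a / 2 * (γ * ‖j‖ ^ 2) := by
  set r : ℝ := ‖k • j‖ / κ with hr
  have hrκ : ‖k • j‖ = κ * r := by rw [hr]; field_simp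
  have hj : a * (γ * ‖j‖ ^ 2) = 4 * (κ * r ^ 2) := by
    have h : (κ * r) ^ 2 = k ^ 2 * ‖j‖ ^ 2 := by
      rw [← hrκ, norm_smul, mul_pow, Real.norm_eq_abs, sq_abs]
    have : κ * (a * (γ * ‖j‖ ^ 2)) = κ * (4 * (κ * r ^ 2)) := by
      linear_combination ‖j‖ ^ 2 * hγ - 4 * h
    exact mul_left_cancel₀ hκ.ne' this
  have e1 : ⟪w, P w⟫ ≤ _ := inner_le_of_norm_le (hP w)
  have e2 : ⟪q, P w⟫ ≤ _ := inner_le_of_norm_le (hP w)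
  have e3 : ⟪w, C q⟫ ≤ _ := inner_le_of_norm_le hCq
  have e4 : ⟪w, C s⟫ ≤ _ := inner_le_of_norm_le hCs
  have hG' : ‖-G‖ ≤ κ / 8 * ‖q‖ := by rwa [norm_neg]
  have e5 : ⟪w, -G⟫ ≤ _ := inner_le_of_norm_le hG'
  have e6 : ⟪q, -G⟫ ≤ _ := inner_le_of_norm_le hG'
  have e7 : ⟪s, -G⟫ ≤ _ := inner_le_of_norm_le hG'
  have e8 : ⟪w, k • j⟫ ≤ _ := inner_le_of_norm_le hrκ.le
  have e9 : ⟪q, k • j⟫ ≤ _ := inner_le_of_norm_le hrκ.le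
  have e10 : ⟪s, k • j⟫ ≤ _ := inner_le_of_norm_le hrκ.le
  have e11 : ⟪s, -q⟫ ≤ ‖s‖ * ‖q‖ := by simpa using real_inner_le_norm s (-q)
  have e12 : ⟪s, -w⟫ ≤ ‖s‖ * ‖w‖ := by simpa using real_inner_le_norm s (-w)
  rw [inner_neg_right] at e5 e6 e7 e11 e12
  have e11' := mul_le_mul_of_nonneg_left e11 hκ.le
  have e12' := mul_le_mul_of_nonneg_left e12 hκ.le
  generalize ‖w‖ = W at *
  generalize ‖q‖ = Q at *
  generalize ‖s‖ = S at *
  -- what is left of the dissipation is a positive semidefinite quadratic form in `W`, `Q`, `S`, `r`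
  have key : 0 ≤ κ * ((6 / 8 - 5 / 256) * W ^ 2 + (7 / 8 - 1 / 64) * Q ^ 2 + 1 / 128 * S ^ 2
      + 6 * r ^ 2 - 1 / 8 * (1 + 1 / 64) * (W * Q) - W * r - Q * r
      - 9 / 512 * (S * Q) - 1 / 64 * (S * W) - 1 / 64 * (S * r)) := by
    refine mul_nonneg hκ.le ?_
    nlinarith [sq_nonneg (W - Q), sq_nonneg (W - 2 * r), sq_nonneg (Q - 2 * r),
      sq_nonneg (S - 4 * Q), sq_nonneg (S - 4 * W), sq_nonneg (S - 4 * r), sq_nonneg W,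
      sq_nonneg Q, sq_nonneg r, sq_nonneg S]
  nlinarith

end Energy

/-! ### Block coordinates of the state space -/

section Blocks

variable {n : ℕ}

/-- The projection to the `k`-th block of a state, as a continuous linear map. -/
noncomputable def blockCLM (k : Fin 4) : LoopState n →L[ℝ] Joint n :=
  LinearMap.toContinuousLinearMap
    { toFun := fun x => x.block k
      map_add' := fun _ _ => rfl
      map_smul' := fun _ _ => rfl }

@[fun_prop]
lemma contDiff_block (k : Fin 4) {r : WithTop ℕ∞} :
    ContDiff ℝ r fun x : LoopState n => x.block k :=
  (blockCLM k).contDiff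

@[simp] lemma block_mk_zero (a b c d : Joint n) : (LoopState.mk a b c d).block 0 = a := rfl
@[simp] lemma block_mk_one (a b c d : Joint n) : (LoopState.mk a b c d).block 1 = b := rfl
@[simp] lemma block_mk_two (a b c d : Joint n) : (LoopState.mk a b c d).block 2 = c := rfl
@[simp] lemma block_mk_three (a b c d : Joint n) : (LoopState.mk a b c d).block 3 = d := rfl

@[simp] lemma block_add (x y : LoopState n) (k : Fin 4) :
    (x + y).block k = x.block k + y.block k := rfl
@[simp] lemma block_smul (c : ℝ) (x : LoopState n) (k : Fin 4) :
    (c • x).block k = c • x.block k := rfl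

lemma LoopState.ext_block {x y : LoopState n} (h0 : x.block 0 = y.block 0)
    (h1 : x.block 1 = y.block 1) (h2 : x.block 2 = y.block 2) (h3 : x.block 3 = y.block 3) :
    x = y := by
  have h : ∀ k, x.block k = y.block k := by
    intro k
    fin_cases k <;> assumption
  ext ⟨k, j⟩
  exact congrArg (fun v : Joint n => v j) (h k)

lemma LoopState.norm_sq_eq (x : LoopState n) :
    ‖x‖ ^ 2 = ‖x.block 0‖ ^ 2 + ‖x.block 1‖ ^ 2 + ‖x.block 2‖ ^ 2 + ‖x.block 3‖ ^ 2 := by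
  simp only [EuclideanSpace.norm_sq_eq, Fintype.sum_prod_type, Fin.sum_univ_four]
  rfl

lemma LoopState.norm_block_le (x : LoopState n) (k : Fin 4) : ‖x.block k‖ ≤ ‖x‖ := by
  refine (sq_le_sq₀ (norm_nonneg _) (norm_nonneg _)).1 ?_
  rw [x.norm_sq_eq]
  fin_cases k <;> simp <;> nlinarith [sq_nonneg ‖x.block 0‖, sq_nonneg ‖x.block 1‖,
    sq_nonneg ‖x.block 2‖, sq_nonneg ‖x.block 3‖]

lemma contDiff_mk {E : Type*} [NormedAddCommGroup E] [NormedSpace ℝ E] {a b c d : E → Joint n}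
    {r : WithTop ℕ∞} (ha : ContDiff ℝ r a) (hb : ContDiff ℝ r b) (hc : ContDiff ℝ r c)
    (hd : ContDiff ℝ r d) : ContDiff ℝ r fun x => LoopState.mk (a x) (b x) (c x) (d x) := by
  rw [contDiff_euclidean] at ha hb hc hd ⊢
  rintro ⟨k, j⟩
  fin_cases k
  exacts [ha j, hb j, hc j, hd j]

end Blocks

/-! ### The closed loop with balanced gains -/

section BalancedLoop

open scoped RealInnerProductSpace

variable {n : ℕ} {M : Robot n} (m : Motor) (R' : ℝ) (qs : Joint n) (κ : ℝ)

/-- The gains for which the proportional gain left over after the completion of the square,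
`k_p - k_i / ε` with `ε = 1`, the derivative gain and the integral gain all equal `κ`. -/
def balancedGains (κ : ℝ) : PIDGains := ⟨2 * κ, κ, κ⟩

/-- The linear change of coordinates from the error state `x` to the error state `z`, for the
balanced gains and `ε = 1`. -/
noncomputable def toTilde (hκ : κ ≠ 0) : LoopState n ≃L[ℝ] LoopState n :=
  LinearEquiv.toContinuousLinearEquiv
    { toFun := fun x => LoopState.mk (x.block 0) (x.block 1) (x.block 0 - κ⁻¹ • x.block 2)
        (x.block 3 - m.k_t⁻¹ • (-((2 * κ) • x.block 0) - κ • x.block 1 + x.block 2))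
      invFun := fun z => LoopState.mk (z.block 0) (z.block 1) (κ • (z.block 0 - z.block 2))
        (z.block 3 + m.k_t⁻¹ • (-((2 * κ) • z.block 0) - κ • z.block 1
          + κ • (z.block 0 - z.block 2)))
      map_add' := fun x y => by
        apply LoopState.ext_block <;> simp only [block_mk_zero, block_mk_one, block_mk_two,
          block_mk_three, block_add] <;> module
      map_smul' := fun c x => by
        apply LoopState.ext_block <;> simp only [block_mk_zero, block_mk_one, block_mk_two,
          block_mk_three, block_smul, RingHom.id_apply] <;> module
      left_inv := fun x => by
        apply LoopState.ext_block <;> simp [hκ]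
      right_inv := fun z => by
        apply LoopState.ext_block <;> simp [hκ] }

lemma toTilde_apply (hκ : κ ≠ 0) (x : LoopState n) :
    toTilde m κ hκ x = LoopState.mk (x.block 0) (x.block 1) (x.block 0 - κ⁻¹ • x.block 2)
      (x.block 3 - m.k_t⁻¹ • (-((2 * κ) • x.block 0) - κ • x.block 1 + x.block 2)) := rfl

lemma toTilde_closedLoop (hκ : κ ≠ 0) (t : ℝ) (x : LoopState n) :
    toTilde m κ hκ (closedLoop M m R' qs t x (balancedGains κ))
      = closedLoopTilde M m R' qs 1 t (toTilde m κ hκ x) (balancedGains κ) := by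
  have hν : M.g qs + κ • ((1 : ℝ)⁻¹ • x.block 0 - (x.block 0 - κ⁻¹ • x.block 2))
      = M.g qs + x.block 2 := by simp [hκ]
  have hi : currentRef m qs (balancedGains κ) (qs + x.block 0) (x.block 1) (M.g qs + x.block 2)
      + (x.block 3 - m.k_t⁻¹ • (-((2 * κ) • x.block 0) - κ • x.block 1 + x.block 2))
      = m.k_t⁻¹ • M.g qs + x.block 3 := by
    simp only [currentRef, torqueRef, balancedGains, add_sub_cancel_left]
    module
  simp only [toTilde_apply, closedLoopTilde, closedLoop, block_mk_zero, block_mk_one,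
    block_mk_two, block_mk_three]
  have hk : (balancedGains κ).k_i = κ := rfl
  rw [hk, hν, hi]
  apply LoopState.ext_block <;> simp [currentRefRate, balancedGains]

lemma contDiff_closedLoopTilde (hM : M.StandingAssumption) (ε : ℝ) (θ : PIDGains) (t : ℝ) :
    ContDiff ℝ 1 fun z => closedLoopTilde M m R' qs ε t z θ := by
  have hacc : ∀ u : LoopState n → Joint n, ContDiff ℝ 1 u →
      ContDiff ℝ 1 fun z : LoopState n => M.accel (qs + z.block 0) (z.block 1) (u z) := by
    intro u hu
    exact hM.contDiff_accel.comp (f := fun z : LoopState n => (qs + z.block 0, z.block 1, u z))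
      (by fun_prop)
  unfold closedLoopTilde
  refine contDiff_mk (by fun_prop) (hacc _ ?_) ?_ ?_ <;>
    simp only [integratorRate, currentRate, voltage, currentRefRate, currentRef, torqueRef]
  · fun_prop
  · fun_prop
  · have := hacc (fun z => m.k_t • (m.k_t⁻¹ • (-(θ.k_p • (qs + z.block 0 - qs)) - θ.k_d • z.block 1
      + (M.g qs + θ.k_i • (ε⁻¹ • z.block 0 - z.block 2))) + z.block 3)) (by fun_prop)
    fun_prop

/-- The energy function of the error system, as a function of the error state `z`. -/
noncomputable def loopEnergy (M : Robot n) (qs : Joint n) (κ γ : ℝ) (z : LoopState n) : ℝ :=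
  energy (matOp n (M.D (qs + z.block 0))) κ γ (z.block 0) (z.block 1) (z.block 2) (z.block 3)

lemma differentiable_loopEnergy (hM : M.StandingAssumption) (γ : ℝ) :
    Differentiable ℝ (loopEnergy M qs κ γ) := by
  have hb : ∀ k, Differentiable ℝ fun z : LoopState n => z.block k := fun k =>
    (blockCLM k).differentiable
  have hP : Differentiable ℝ fun z : LoopState n => matOp n (M.D (qs + z.block 0)) := fun z =>
    ((matOp n).differentiableAt.comp _ (hM.differentiable_D _)).comp z ((hb 0 z).const_add qs)
  have hPw := hP.clm_apply (hb 1)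
  exact (((((((hb 1).inner ℝ hPw).const_mul _).add ((hb 0).inner ℝ hPw)).add
    (((hb 0).norm_sq ℝ).const_mul κ)).add (((hb 2).norm_sq ℝ).const_mul _)).add
    (((hb 2).inner ℝ hPw).const_mul _)).add (((hb 3).norm_sq ℝ).const_mul γ)

/-- The current error obeys `L j' = -(R + R') j`, whatever the robot does. -/
lemma block_three_closedLoopTilde (hL : m.L ≠ 0) (ε t : ℝ) (z : LoopState n) (θ : PIDGains) :
    (closedLoopTilde M m R' qs ε t z θ).block 3 = -(((m.R + R') / m.L) • z.block 3) := by
  simp only [closedLoopTilde, block_mk_three, currentRate, voltage, add_sub_cancel_left]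
  match_scalars <;> field_simp <;> ring

lemma D_block_one_closedLoopTilde (hM : M.StandingAssumption) (hk : m.k_t ≠ 0) (t : ℝ)
    (z : LoopState n) :
    matOp n (M.D (qs + z.block 0)) ((closedLoopTilde M m R' qs 1 t z (balancedGains κ)).block 1)
      = -matOp n (M.C (qs + z.block 0) (z.block 1)) (z.block 1)
        - (M.g (qs + z.block 0) - M.g qs) - κ • z.block 0 - κ • z.block 1 - κ • z.block 2
        + m.k_t • z.block 3 := by
  simp only [closedLoopTilde, block_mk_one, hM.D_accel, currentRef, torqueRef, balancedGains,
    add_sub_cancel_left, smul_add, smul_inv_smul₀ hk]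
  module

lemma fderiv_loopEnergy_le (hM : M.StandingAssumption) (hL : 0 < m.L) (hk : 0 < m.k_t)
    (hR' : -m.R < R') {κ γ k_c k_g d_M : ℝ} (hκ : 0 < κ)
    (hD : ∀ q, ‖M.D q‖ ≤ d_M) (hC : ∀ q w, ‖M.C q w‖ ≤ k_c * ‖w‖)
    (hg : ∀ q, ‖fderiv ℝ M.g q‖ ≤ k_g) (hdκ : d_M ≤ κ / 8) (hgκ : k_g ≤ κ / 8)
    (hγ : (m.R + R') / m.L * κ * γ = 4 * m.k_t ^ 2) (hγ0 : 0 ≤ γ)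
    (t : ℝ) (z : LoopState n) (hq : k_c * ‖z.block 0‖ ≤ κ / 8) (hs : k_c * ‖z.block 2‖ ≤ κ / 8) :
    fderiv ℝ (loopEnergy M qs κ γ) z (closedLoopTilde M m R' qs 1 t z (balancedGains κ))
      ≤ -min (1 / 128) ((m.R + R') / m.L / 2) * loopEnergy M qs κ γ z := by
  set v := closedLoopTilde M m R' qs 1 t z (balancedGains κ) with hv
  set a := (m.R + R') / m.L
  have hline : ∀ k, HasDerivAt (fun τ : ℝ => (z + τ • v).block k) (v.block k) 0 := fun k => by
    simpa using! ((hasDerivAt_id (0 : ℝ)).smul_const (v.block k)).const_add (z.block k)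
  have hzero : ∀ k, (z + (0 : ℝ) • v).block k = z.block k := fun k => by simp
  have h0 : v.block 0 = z.block 1 := rfl
  have h2 : v.block 2 = z.block 1 + z.block 0 := by
    simp [hv, closedLoopTilde, integratorRate, balancedGains, hκ.ne']
  have h3 : v.block 3 = -(a • z.block 3) := block_three_closedLoopTilde m R' qs hL.ne' _ _ _ _
  have hder := HasDerivAt.energy
    (hM.hasDerivAt_D (q₀ := qs + z.block 0) ((hline 0).const_add qs) (by rw [hzero]))
    (hline 0) (hline 1) (hline 2) (hline 3) κ γ
  simp only [hzero, h0, h2, h3] at hder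
  rw [energy_rate_eq (hM.inner_D_comm _) (hM.inner_fderiv_D (qs + z.block 0) (z.block 1)) κ γ a
    m.k_t (z.block 0) (z.block 1) (z.block 2) (z.block 3) (M.g (qs + z.block 0) - M.g qs)
    (v.block 1) (D_block_one_closedLoopTilde m R' qs κ hM hk.ne' t z)] at hder
  have hlineZ : HasDerivAt (fun τ : ℝ => z + τ • v) v 0 := by
    simpa using ((hasDerivAt_id (0 : ℝ)).smul_const v).const_add z
  have hf : HasDerivAt (fun τ : ℝ => loopEnergy M qs κ γ (z + τ • v))
      (fderiv ℝ (loopEnergy M qs κ γ) z v) 0 :=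
    HasFDerivAt.comp_hasDerivAt_of_eq (0 : ℝ) (differentiable_loopEnergy qs κ hM γ z).hasFDerivAt
      hlineZ (by simp)
  rw [hf.unique hder]
  have hP : ∀ x, ‖matOp n (M.D (qs + z.block 0)) x‖ ≤ κ / 8 * ‖x‖ := fun x =>
    (norm_matOp_le _ x).trans (by gcongr; exact (hD _).trans hdκ)
  have hCx : ∀ x : Joint n, k_c * ‖x‖ ≤ κ / 8 →
      ‖matOp n (M.C (qs + z.block 0) (z.block 1)) x‖ ≤ κ / 8 * ‖z.block 1‖ := fun x hx => by
    calc _ ≤ k_c * ‖z.block 1‖ * ‖x‖ :=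
          (norm_matOp_le _ x).trans (mul_le_mul_of_nonneg_right (hC _ _) (norm_nonneg x))
      _ = k_c * ‖x‖ * ‖z.block 1‖ := by ring
      _ ≤ _ := by gcongr
  have hG : ‖M.g (qs + z.block 0) - M.g qs‖ ≤ κ / 8 * ‖z.block 0‖ := by
    have := Convex.norm_image_sub_le_of_norm_fderiv_le (𝕜 := ℝ) (f := M.g) (s := Set.univ)
      (fun x _ => hM.contDiff_g.differentiable (by norm_num) x) (fun x _ => (hg x).trans hgκ)
      convex_univ (Set.mem_univ qs) (Set.mem_univ (qs + z.block 0))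
    simpa using this
  refine (energy_rate_le hκ hP (hCx _ hq) (hCx _ hs) hG hγ).trans ?_
  have hup := energy_le hκ.le hP γ (z.block 0) (z.block 1) (z.block 2) (z.block 3)
  have hapos : 0 < a := div_pos (by linarith) hL
  set c := min (1 / 128) (a / 2)
  have hc0 : 0 ≤ c := le_min (by norm_num) (by positivity)
  have hc1 : c ≤ 1 / 128 := min_le_left _ _
  have hc2 : c ≤ a / 2 := min_le_right _ _
  have e1 : 0 ≤ κ * (‖z.block 1‖ ^ 2 + 2 * ‖z.block 0‖ ^ 2 + ‖z.block 2‖ ^ 2) := by positivity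
  have e2 : 0 ≤ γ * ‖z.block 3‖ ^ 2 := by positivity
  have e3 := mul_le_mul_of_nonneg_left hup hc0
  have e4 := mul_le_mul_of_nonneg_right hc1 e1
  have e5 := mul_le_mul_of_nonneg_right hc2 e2
  unfold loopEnergy
  linarith

end BalancedLoop

/-! ### Semiglobal stability -/

section Semiglobal

open scoped RealInnerProductSpace

variable {n : ℕ} {M : Robot n}

/-- Stability in any linear coordinates `T` in which the energy is at most `r` on the ball: on the
sublevel set the position error is bounded, so the inertia matrix is bounded below there. -/
lemma isUASOn_of_loopEnergy_le (hM : M.StandingAssumption) (m : Motor) (hL : 0 < m.L)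
    (hk : 0 < m.k_t) {R' : ℝ} (hR' : -m.R < R') (qs : Joint n)
    {κ γ k_c k_g d_M r Δ : ℝ} (hκ : 0 < κ)
    (hD : ∀ q, ‖M.D q‖ ≤ d_M) (hC : ∀ q w, ‖M.C q w‖ ≤ k_c * ‖w‖) (hkc : 0 ≤ k_c)
    (hg : ∀ q, ‖fderiv ℝ M.g q‖ ≤ k_g) (hdκ : d_M ≤ κ / 8) (hgκ : k_g ≤ κ / 8)
    (hγ : (m.R + R') / m.L * κ * γ = 4 * m.k_t ^ 2) (hγ0 : 0 < γ) (hΔ : 0 ≤ Δ) (hr : 0 < r)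
    (hrκ : k_c ^ 2 * (4 * r) ≤ κ * (κ / 8) ^ 2) (T : LoopState n ≃L[ℝ] LoopState n)
    (F : ℝ → LoopState n → LoopState n)
    (hF : ∀ t x, T (F t x) = closedLoopTilde M m R' qs 1 t (T x) (balancedGains κ))
    (hball : ∀ x, ‖x‖ ≤ Δ → loopEnergy M qs κ γ (T x) ≤ r) : IsUASOn F Δ := by
  have hF0 : F = fun _ x => T.symm (closedLoopTilde M m R' qs 1 0 (T x) (balancedGains κ)) := by
    funext t x
    exact (T.symm_apply_eq.2 (hF t x).symm).symm
  have hP : ∀ q x, ‖matOp n (M.D q) x‖ ≤ κ / 8 * ‖x‖ := fun q x =>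
    (norm_matOp_le _ x).trans (by gcongr; exact (hD _).trans hdκ)
  have hlow : ∀ z : LoopState n, 1 / 8 * ⟪z.block 1, matOp n (M.D (qs + z.block 0)) (z.block 1)⟫
      + κ / 2 * ‖z.block 0‖ ^ 2 + κ / 4 * ‖z.block 2‖ ^ 2 + γ * ‖z.block 3‖ ^ 2
      ≤ loopEnergy M qs κ γ z := fun z =>
    le_energy (hM.inner_D_comm _) (hM.inner_D_nonneg _) hκ.le (hP _) γ _ _ _ _
  have hbound : ∀ z : LoopState n, loopEnergy M qs κ γ z ≤ r →
      κ * ‖z.block 0‖ ^ 2 ≤ 4 * r ∧ κ * ‖z.block 2‖ ^ 2 ≤ 4 * r := fun z hz => by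
    have h1 := hM.inner_D_nonneg (qs + z.block 0) (z.block 1)
    have h2 := hlow z
    have h3 : 0 ≤ κ * ‖z.block 0‖ ^ 2 := by positivity
    have h4 : 0 ≤ κ * ‖z.block 2‖ ^ 2 := by positivity
    have h5 : 0 ≤ γ * ‖z.block 3‖ ^ 2 := by positivity
    constructor <;> linarith
  have hsmall : ∀ y : Joint n, κ * ‖y‖ ^ 2 ≤ 4 * r → k_c * ‖y‖ ≤ κ / 8 := fun y hy => by
    refine (sq_le_sq₀ (by positivity) (by positivity)).1 (le_of_mul_le_mul_left ?_ hκ)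
    calc κ * (k_c * ‖y‖) ^ 2 = k_c ^ 2 * (κ * ‖y‖ ^ 2) := by ring
      _ ≤ k_c ^ 2 * (4 * r) := by gcongr
      _ ≤ _ := hrκ
  obtain ⟨d, hd, hdlow⟩ := hM.exists_inner_D_ge qs √(4 * r / κ)
  set α := min (d / 8) (min (κ / 4) γ)
  have hα0 : 0 < α := lt_min (by positivity) (lt_min (by positivity) hγ0)
  have hα1 : α ≤ d / 8 := min_le_left _ _
  have hα2 : α ≤ κ / 4 := (min_le_right _ _).trans (min_le_left _ _)
  have hα3 : α ≤ γ := (min_le_right _ _).trans (min_le_right _ _)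
  have hlow' : ∀ z : LoopState n, loopEnergy M qs κ γ z ≤ r →
      α * ‖z‖ ^ 2 ≤ loopEnergy M qs κ γ z := fun z hz => by
    have h1 := hdlow (z.block 0) (z.block 1) (Real.le_sqrt_of_sq_le
      ((le_div_iff₀ hκ).2 (by linarith [(hbound z hz).1])))
    have h2 := hlow z
    have e1 := mul_le_mul_of_nonneg_right hα1 (sq_nonneg ‖z.block 1‖)
    have e0 := mul_le_mul_of_nonneg_right hα2 (sq_nonneg ‖z.block 0‖)
    have e2 := mul_le_mul_of_nonneg_right hα2 (sq_nonneg ‖z.block 2‖)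
    have e3 := mul_le_mul_of_nonneg_right hα3 (sq_nonneg ‖z.block 3‖)
    have e4 : 0 ≤ κ * ‖z.block 0‖ ^ 2 := by positivity
    rw [z.norm_sq_eq]
    linarith
  have hup' : ∀ z : LoopState n, loopEnergy M qs κ γ z ≤ (2 * κ + γ) * ‖z‖ ^ 2 := fun z => by
    refine (energy_le hκ.le (hP _) γ _ _ _ _).trans ?_
    rw [z.norm_sq_eq]
    have e0 := mul_nonneg hγ0.le (sq_nonneg ‖z.block 0‖)
    have e1 := mul_nonneg hγ0.le (sq_nonneg ‖z.block 1‖)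
    have e2 := mul_nonneg hγ0.le (sq_nonneg ‖z.block 2‖)
    have f1 := mul_nonneg hκ.le (sq_nonneg ‖z.block 1‖)
    have f2 := mul_nonneg hκ.le (sq_nonneg ‖z.block 2‖)
    have f3 := mul_nonneg hκ.le (sq_nonneg ‖z.block 3‖)
    linarith
  have hsymmT : ∀ x, ‖x‖ ^ 2 ≤ (‖(T.symm : LoopState n →L[ℝ] LoopState n)‖ ^ 2 + 1)
      * ‖T x‖ ^ 2 := fun x => by
    have h := (T.symm : LoopState n →L[ℝ] LoopState n).le_opNorm (T x)
    simp only [ContinuousLinearEquiv.coe_coe, ContinuousLinearEquiv.symm_apply_apply] at h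
    have h2 := pow_le_pow_left₀ (norm_nonneg _) h 2
    nlinarith [sq_nonneg ‖T x‖]
  have hTT : ∀ x, ‖T x‖ ^ 2 ≤ (‖(T : LoopState n →L[ℝ] LoopState n)‖ ^ 2 + 1)
      * ‖x‖ ^ 2 := fun x => by
    have h := (T : LoopState n →L[ℝ] LoopState n).le_opNorm x
    simp only [ContinuousLinearEquiv.coe_coe] at h
    have h2 := pow_le_pow_left₀ (norm_nonneg _) h 2
    nlinarith [sq_nonneg ‖x‖]
  have hdiff := differentiable_loopEnergy qs κ hM γ
  have hapos : 0 < (m.R + R') / m.L := div_pos (by linarith) hL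
  rw [hF0]
  refine isUASOn_of_lyapunov (W := fun x => loopEnergy M qs κ γ (T x)) (r := r)
    (a := α / (‖(T.symm : LoopState n →L[ℝ] LoopState n)‖ ^ 2 + 1))
    (b := (2 * κ + γ) * (‖(T : LoopState n →L[ℝ] LoopState n)‖ ^ 2 + 1))
    (c := min (1 / 128) ((m.R + R') / m.L / 2))
    (T.symm.contDiff.comp ((contDiff_closedLoopTilde m R' qs hM 1 _ 0).comp T.contDiff))
    (hdiff.comp T.differentiable) hΔ hr (by positivity) (by positivity)
    (lt_min (by norm_num) (by positivity)) hball (fun x hx => ?_) (fun x _ => ?_) fun x hx => ?_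
  · refine le_trans ?_ (hlow' _ hx)
    rw [div_mul_eq_mul_div, div_le_iff₀ (by positivity), mul_assoc]
    refine mul_le_mul_of_nonneg_left ?_ hα0.le
    rw [mul_comm]
    exact hsymmT x
  · refine (hup' _).trans ?_
    rw [mul_assoc]
    exact mul_le_mul_of_nonneg_left (hTT x) (by positivity)
  · have hcomp : fderiv ℝ (fun x => loopEnergy M qs κ γ (T x)) x
        = (fderiv ℝ (loopEnergy M qs κ γ) (T x)).comp (T : LoopState n →L[ℝ] LoopState n) :=
      T.comp_right_fderiv (f := loopEnergy M qs κ γ)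
    rw [hcomp]
    simp only [ContinuousLinearMap.comp_apply, ContinuousLinearEquiv.coe_coe, Function.comp_apply,
      ContinuousLinearEquiv.apply_symm_apply]
    obtain ⟨hb0, hb2⟩ := hbound _ hx
    exact fderiv_loopEnergy_le m R' qs hM hL hk hR' hκ hD hC hg hdκ hgκ hγ hγ0.le 0 (T x)
      (hsmall _ hb0) (hsmall _ hb2)

/-- Gains proportional to `1 + Δ` stabilize the ball of radius `Δ`, in both error states. The energy
on the ball is `O(κ Δ²)` although the initial current error is `O(κ Δ)`, because its weight `γ`
is `O(1 / κ)`; so the sublevel set reaches position errors `O(Δ)`, for which the Coriolis terms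
are dominated by `κ`. -/
lemma isUASOn_balancedGains (hM : M.StandingAssumption) (m : Motor) (hL : 0 < m.L)
    (hk : 0 < m.k_t) {R' : ℝ} (hR' : -m.R < R') (qs : Joint n) {κ k_c k_g d_M Δ : ℝ}
    (hD : ∀ q, ‖M.D q‖ ≤ d_M) (hC : ∀ q w, ‖M.C q w‖ ≤ k_c * ‖w‖) (hkc : 0 < k_c)
    (hg : ∀ q, ‖fderiv ℝ M.g q‖ ≤ k_g) (hΔ : 0 < Δ) (hdκ : 8 * d_M ≤ κ) (hgκ : 8 * k_g ≤ κ)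
    (hkκ : 1 + m.k_t ≤ κ)
    (hcκ : 8 * k_c * (28 + 256 / ((m.R + R') / m.L)) * Δ ≤ κ) :
    IsUASOn (fun t x => closedLoop M m R' qs t x (balancedGains κ)) Δ ∧
      IsUASOn (fun t z => closedLoopTilde M m R' qs 1 t z (balancedGains κ)) Δ := by
  have hκ1 : 1 ≤ κ := by linarith
  have hκ : 0 < κ := by linarith
  have ha : 0 < (m.R + R') / m.L := div_pos (by linarith) hL
  set a := (m.R + R') / m.L
  set γ := 4 * m.k_t ^ 2 / (a * κ) with hγdef
  have hγ0 : 0 < γ := by positivity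
  have hγ : a * κ * γ = 4 * m.k_t ^ 2 := by rw [hγdef]; field_simp
  set r := κ * Δ ^ 2 * (7 + 64 / a) with hrdef
  have hr : 0 < r := by positivity
  have hrκ : k_c ^ 2 * (4 * r) ≤ κ * (κ / 8) ^ 2 := by
    have h1 : (8 * k_c * (28 + 256 / a) * Δ) ^ 2 ≤ κ ^ 2 := pow_le_pow_left₀ (by positivity) hcκ 2
    have h2 : (28 + 256 / a) ≤ (28 + 256 / a) ^ 2 := by
      have : 0 < 256 / a := by positivity
      nlinarith
    have h3 := mul_le_mul_of_nonneg_left h2 (by positivity : 0 ≤ (8 * k_c * Δ) ^ 2)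
    calc k_c ^ 2 * (4 * r) = κ / 64 * ((8 * k_c * Δ) ^ 2 * (28 + 256 / a)) := by
          rw [hrdef]; ring
      _ ≤ κ / 64 * κ ^ 2 := by
          refine mul_le_mul_of_nonneg_left (h3.trans ?_) (by positivity)
          calc _ = (8 * k_c * (28 + 256 / a) * Δ) ^ 2 := by ring
            _ ≤ _ := h1
      _ = _ := by ring
  have hE : ∀ z : LoopState n, ‖z.block 0‖ ≤ Δ → ‖z.block 1‖ ≤ Δ → ‖z.block 2‖ ≤ 2 * Δ →
      m.k_t * ‖z.block 3‖ ≤ 4 * κ * Δ → loopEnergy M qs κ γ z ≤ r := by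
    intro z h0 h1 h2 h3
    refine (energy_le hκ.le (fun x => (norm_matOp_le _ x).trans ?_) γ _ _ _ _).trans ?_
    · exact mul_le_mul_of_nonneg_right ((hD _).trans (by linarith)) (norm_nonneg x)
    have e0 := pow_le_pow_left₀ (norm_nonneg _) h0 2
    have e1 := pow_le_pow_left₀ (norm_nonneg _) h1 2
    have e2 := pow_le_pow_left₀ (norm_nonneg _) h2 2
    have e3 := pow_le_pow_left₀ (by positivity) h3 2
    have e4 : γ * ‖z.block 3‖ ^ 2 ≤ 64 / a * (κ * Δ ^ 2) := by
      calc γ * ‖z.block 3‖ ^ 2 = 4 / (a * κ) * (m.k_t * ‖z.block 3‖) ^ 2 := by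
            rw [hγdef]; ring
        _ ≤ 4 / (a * κ) * (4 * κ * Δ) ^ 2 := by gcongr
        _ = _ := by field_simp; ring
    have e5 : κ * (‖z.block 1‖ ^ 2 + 2 * ‖z.block 0‖ ^ 2 + ‖z.block 2‖ ^ 2)
        ≤ κ * (7 * Δ ^ 2) := mul_le_mul_of_nonneg_left (by nlinarith) hκ.le
    rw [hrdef]
    nlinarith
  have key := isUASOn_of_loopEnergy_le hM m hL hk hR' qs hκ hD hC hkc.le hg (by linarith)
    (by linarith) hγ hγ0 hΔ.le hr hrκ
  refine ⟨key (toTilde m κ hκ.ne') _ (toTilde_closedLoop m R' qs κ hκ.ne') fun x hx => ?_,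
    key (ContinuousLinearEquiv.refl ℝ _) _ (fun _ _ => rfl) fun z hz => ?_⟩
  · have hb := fun k => (x.norm_block_le k).trans hx
    refine hE _ (hb 0) (hb 1) ?_ ?_
    · rw [toTilde_apply, block_mk_two]
      have h1 : ‖κ⁻¹ • x.block 2‖ ≤ Δ := by
        rw [norm_smul, norm_inv, Real.norm_eq_abs, abs_of_pos hκ]
        exact (mul_le_of_le_one_left (norm_nonneg _) (inv_le_one_of_one_le₀ hκ1)).trans (hb 2)
      linarith [norm_sub_le (x.block 0) (κ⁻¹ • x.block 2), hb 0]
    · rw [toTilde_apply, block_mk_three]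
      have h1 : m.k_t • (x.block 3 - m.k_t⁻¹ • (-((2 * κ) • x.block 0) - κ • x.block 1 + x.block 2))
          = m.k_t • x.block 3 + (2 * κ) • x.block 0 + κ • x.block 1 - x.block 2 := by
        rw [smul_sub, smul_inv_smul₀ hk.ne']
        module
      have h2 : ∀ y : Joint n, m.k_t * ‖y‖ = ‖m.k_t • y‖ := fun y => by
        rw [norm_smul, Real.norm_eq_abs, abs_of_pos hk]
      rw [h2, h1]
      have n1 : ‖m.k_t • x.block 3‖ ≤ m.k_t * Δ := by
        rw [norm_smul, Real.norm_eq_abs, abs_of_pos hk]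
        exact mul_le_mul_of_nonneg_left (hb 3) hk.le
      have n2 : ‖(2 * κ) • x.block 0‖ ≤ 2 * κ * Δ := by
        rw [norm_smul, Real.norm_eq_abs, abs_of_pos (by positivity)]
        exact mul_le_mul_of_nonneg_left (hb 0) (by positivity)
      have n3 : ‖κ • x.block 1‖ ≤ κ * Δ := by
        rw [norm_smul, Real.norm_eq_abs, abs_of_pos hκ]
        exact mul_le_mul_of_nonneg_left (hb 1) hκ.le
      have t1 := norm_sub_le (m.k_t • x.block 3 + (2 * κ) • x.block 0 + κ • x.block 1) (x.block 2)
      have t2 := norm_add₃_le (a := m.k_t • x.block 3) (b := (2 * κ) • x.block 0)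
        (c := κ • x.block 1)
      have t3 := mul_le_mul_of_nonneg_right hkκ hΔ.le
      linarith [hb 2]
  · have hb := fun k => (z.norm_block_le k).trans hz
    have h3 : m.k_t * ‖z.block 3‖ ≤ κ * Δ :=
      mul_le_mul (by linarith) (hb 3) (norm_nonneg _) hκ.le
    have h4 : 0 < κ * Δ := by positivity
    exact hE _ (hb 0) (hb 1) ((hb 2).trans (by linarith)) (h3.trans (by linarith))

end Semiglobal

theorem proposition4 {n : ℕ} (M : Robot n) (hM : M.StandingAssumption)
    (m : Motor) (hL : 0 < m.L) (hR : 0 < m.R) (hk_t : 0 < m.k_t)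
    (R' : ℝ) (hR' : -m.R < R') (qs : Joint n) :
    IsUSAS positiveGains (closedLoop M m R' qs) ∧
    ∃ a_p b_p a_d b_d a_i b_i ε : ℝ,
      0 < a_p ∧ 0 < b_p ∧ 0 < a_d ∧ 0 < b_d ∧ 0 < a_i ∧ 0 < b_i ∧ 0 < ε ∧
      ∀ Δ : ℝ, 0 < Δ → ∀ θ : PIDGains,
        θ.k_d = a_d + b_d * Δ → θ.k_i = a_i + b_i * Δ →
        θ.k_p - θ.k_i / ε = a_p + b_p * Δ →
        IsUASOn (fun t x => closedLoop M m R' qs t x θ) Δ ∧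
        IsUASOn (fun t z => closedLoopTilde M m R' qs ε t z θ) Δ := by
  obtain ⟨_, d_M, _, hdM, hD⟩ := hM.bound_D
  obtain ⟨k_c, hkc, hC⟩ := hM.bound_C
  obtain ⟨k_g, hkg, hg⟩ := hM.bound_g
  have ha : 0 < (m.R + R') / m.L := div_pos (by linarith) hL
  -- one slope serves for all gains, with `ε = 1`
  set A := 1 + m.k_t + 8 * d_M + 8 * k_g + 8 * k_c * (28 + 256 / ((m.R + R') / m.L)) with hA
  have hB : 0 < 8 * k_c * (28 + 256 / ((m.R + R') / m.L)) := by positivity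
  have hA0 : 0 < A := by positivity
  have main : ∀ Δ : ℝ, 0 < Δ →
      IsUASOn (fun t x => closedLoop M m R' qs t x (balancedGains (A + A * Δ))) Δ ∧
      IsUASOn (fun t z => closedLoopTilde M m R' qs 1 t z (balancedGains (A + A * Δ))) Δ := by
    intro Δ hΔ
    have hAΔ : 0 < A * Δ := mul_pos hA0 hΔ
    refine isUASOn_balancedGains hM m hL hk_t hR' qs (fun q => (hD q).2) hC hkc hg hΔ
      (by linarith) (by linarith) (by linarith) ?_
    have := mul_le_mul_of_nonneg_right
      (by linarith : 8 * k_c * (28 + 256 / ((m.R + R') / m.L)) ≤ A) hΔ.le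
    linarith
  refine ⟨fun Δ hΔ => ⟨balancedGains (A + A * Δ), ?_, (main Δ hΔ).1⟩, A, A, A, A, A, A, 1,
    hA0, hA0, hA0, hA0, hA0, hA0, one_pos, fun Δ hΔ θ hd hi hp => ?_⟩
  · have : 0 < A + A * Δ := by positivity
    exact ⟨mul_pos two_pos this, this, this⟩
  · have hθ : θ = balancedGains (A + A * Δ) := by
      obtain ⟨kp, kd, ki⟩ := θ
      simp only [div_one] at hd hi hp
      simp only [balancedGains, PIDGains.mk.injEq]
      exact ⟨by linarith, hd, hi⟩
    rw [hθ]
    exact main Δ hΔ
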